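/- Let $R,\alpha>0$, let $\rho\in\mathbb R$ satisfy $$\rho>\frac{1}{\alpha}\sqrt{4\alpha^2R^2+6-2\sqrt{4\alpha^2R^2+9}}$$ (which forces $\rho>R$), let $N\ge 1$ be an integer and $\omega=e^{2\pi i/N}$. Identify $\mathbb R^2$ with $\mathbb C$ and let $y_k=\rho\,\omega^k$ (charge points) and $x_j=R\,\omega^j$ (collocation points), $1\le k,j\le N$. Let $K_\nu$ be the modified Bessel function of the second kind. Let $G=(c_{k,j})_{1\le k,j\le N}$ be the real matrix $$c_{k,j}=-\alpha K_1(\alpha|x_j-y_k|)\,\frac{|x_j|-\operatorname{Re}\big((x_j/|x_j|)\,\overline{y_k}\big)}{|x_j-y_k|},$$ and for $0\le l\le N-1$ put $\theta_l=2\pi l/N$, $$c_l=-\alpha K_1\big(\alpha|R-\rho e^{-i\theta_l}|\big)\frac{R-\rho\cos\theta_l}{|R-\rho e^{-i\theta_l}|},\qquad f(x)=\sum_{l=0}^{N-1}c_l x^l .$$ Then: 1. $G$ is the circulant matrix $c_{k,j}=c_{(j-k)\bmod N}$, and its eigenvalues, counted with algebraic multiplicity, are $f(\omega^m)$, $m=0,\dots,N-1$.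 2. $f(\omega^m)$ is real and $f(\omega^m)>0$ for every $m=0,\dots,N-1$. 3. Consequently, for every real-valued boundary datum $s$ on $\{|x|=R\}$, the system $GQ=(s(x_1),\dots,s(x_N))^T$ has exactly one solution $Q\in\mathbb R^N$. A vector $Q\in\mathbb R^N$ solves this system if and only if $g_N(x)=\sum_{k=1}^N Q_kK_0(\alpha|x-y_k|)$ satisfies the collocation conditions $\frac{\partial g_N}{\partial n}(x_j)=s(x_j)$, $j=1,\dots,N$, where $n$ is the outward unit normal of $\{|x|<R\}$. Hence there is exactly one function $g_N$ of this form satisfying the collocation conditions, that is, the approximate solution by the method of fundamental solutions of the Neumann problem $\Delta g-\alpha^2g=0$ in $|x|<R$, $\partial g/\partial n=s$ on $|x|=R$, is uniquely determined. -/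

import Mathlib

noncomputable section

/-- The modified Bessel function of the second kind `K_ν(x)`, for real order `ν` and `x > 0`:
`K_ν(x) = ∫₀^∞ exp (-x cosh t) cosh (ν t) dt`. -/
def besselK (ν x : ℝ) : ℝ :=
  ∫ t in Set.Ioi (0 : ℝ), Real.exp (-x * Real.cosh t) * Real.cosh (ν * t)

/-- The primitive root of unity `ω = e^{2πi/N}`. -/
def omegaRoot (N : ℕ) : ℂ :=
  Complex.exp (2 * (Real.pi : ℂ) * Complex.I / (N : ℂ))

/-- The points `r ω, r ω², …, r ω^N` (numbered by `Fin N`, starting from `r ω`), equally spaced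
on the circle of radius `r`. They are the charge points `y_k` for `r = ρ` and the collocation
points `x_j` for `r = R`. -/
def circlePoint (r : ℝ) (N : ℕ) (k : Fin N) : ℂ :=
  (r : ℂ) * omegaRoot N ^ ((k : ℕ) + 1)

/-- The function `g_N(x) = ∑ₖ Qₖ K₀(α |x - yₖ|)`, a combination of fundamental solutions of
`Δ - α²` with singularities at the charge points `yₖ`. -/
def mfsFun (α ρ : ℝ) (N : ℕ) (Q : Fin N → ℝ) (x : ℂ) : ℝ :=
  ∑ k : Fin N, Q k * besselK 0 (α * ‖x - circlePoint ρ N k‖)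

/-- At the point `x ≠ 0` of a circle about the origin, `g` has a derivative in the direction of
the outward unit normal `x / |x|`, and this normal derivative is `d`. -/
def HasNormalDerivAt (g : ℂ → ℝ) (d : ℝ) (x : ℂ) : Prop :=
  HasLineDerivAt ℝ g d x (x / (‖x‖ : ℂ))

/-- The collocation equations `∂g_N/∂n (x_j) = s(x_j)`, `j = 1, …, N`. -/
def Collocates (R : ℝ) (N : ℕ) (s g : ℂ → ℝ) : Prop :=
  ∀ j : Fin N, HasNormalDerivAt g (s (circlePoint R N j)) (circlePoint R N j)

/-- `g` is an approximate solution, with boundary datum `s`, given by the method of fundamental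
solutions with collocation. -/
def IsMFSApproximation (α R ρ : ℝ) (N : ℕ) (s g : ℂ → ℝ) : Prop :=
  ∃ Q : Fin N → ℝ, g = mfsFun α ρ N Q ∧ Collocates R N s g

/-- The collocation matrix `G = (c_{k,j})`, where, for the charge points `y_k` and the collocation
points `x_j`,
`c_{k,j} = -α K₁(α |x_j - y_k|) (|x_j| - Re ((x_j / |x_j|) conj y_k)) / |x_j - y_k|`. -/
def mfsMatrix (α R ρ : ℝ) (N : ℕ) : Matrix (Fin N) (Fin N) ℝ :=
  Matrix.of fun k j =>
    let y := circlePoint ρ N k;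
    let x := circlePoint R N j;
    (-α * besselK 1 (α * ‖x - y‖)) *
      ((‖x‖ - ((x / (‖x‖ : ℂ)) * (starRingEnd ℂ) y).re) / ‖x - y‖)

/-- The vector `S = (s(x_1), …, s(x_N))`. -/
def mfsRhs (R : ℝ) (N : ℕ) (s : ℂ → ℝ) : Fin N → ℝ :=
  fun j => s (circlePoint R N j)

/-- The angle `θ_l = 2πl/N`. -/
def mfsAngle (N l : ℕ) : ℝ := 2 * Real.pi * (l : ℝ) / (N : ℝ)

/-- The numbers
`c_l = -α K₁(α |R - ρ e^{-iθ_l}|) (R - ρ cos θ_l) / |R - ρ e^{-iθ_l}|`. -/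
def mfsCoeff (α R ρ : ℝ) (N l : ℕ) : ℝ :=
  let d : ℝ := ‖(R : ℂ) - (ρ : ℂ) * Complex.exp (-Complex.I * (mfsAngle N l : ℂ))‖;
  (-α * besselK 1 (α * d)) * ((R - ρ * Real.cos (mfsAngle N l)) / d)

/-- The polynomial function `f(x) = ∑_{l=0}^{N-1} c_l x^l`. -/
def mfsPoly (α R ρ : ℝ) (N : ℕ) (x : ℂ) : ℂ :=
  ∑ l ∈ Finset.range N, (mfsCoeff α R ρ N l : ℂ) * x ^ l

end

/-! Everything rests on the positivity of f(ω^m), which needs only R < ρ. Each coefficient is an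
integral, c_l = (α/2) ∫_ℝ e^{-αρ cosh t} z e^{αRz} dt with z = cosh(t + iθ_l)
(`mfsCoeff_eq_integral`): the total exponent collapses to -α|w| cosh(t - i arg w), where w = ρ - R
e^{-iθ_l}, and a shift of the line of integration (`integral_exp_neg_mul_cosh_shift`) turns this
into K₁(α|w|). For fixed t, z = aω^l + bω^{-l} with a, b > 0. After expanding the exponential and
the powers of z, summation over l against ω^{lm} keeps only nonnegative terms, not all zero
(`IsPrimitiveRoot.sum_pow_mul_exp_pos`). Hence f(ω^m) integrates a positive function. The matrix G
is circulant, so (ω^{km}) diagonalises it with eigenvalues f(ω^m), and G is invertible. Since K₀' =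
-K₁ and G is symmetric, GQ is the vector of normal derivatives of g_N. -/

open MeasureTheory

/-! ### Integral representations of K₀ and K₁ -/

theorem Real.one_add_sq_le_two_mul_cosh (t : ℝ) : 1 + t ^ 2 ≤ 2 * Real.cosh t := by
  have h1 : Real.cosh t = 1 + 2 * Real.sinh (t / 2) ^ 2 := by
    have h := Real.cosh_two_mul (t / 2)
    rw [mul_div_cancel₀ t two_ne_zero, Real.cosh_sq] at h
    linarith
  have h2 : |t / 2| ≤ |Real.sinh (t / 2)| := by
    rw [Real.abs_sinh]
    exact Real.self_le_sinh_iff.2 (abs_nonneg _)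
  have h3 := sq_le_sq.2 h2
  nlinarith

/-- Since u^{n+1} e^{-cu} is bounded for u > 0, one spare factor cosh t gives domination by a
multiple of 1/(1 + t²). -/
theorem integrable_exp_neg_mul_cosh_mul_pow {c : ℝ} (hc : 0 < c) (n : ℕ) :
    Integrable fun t : ℝ => Real.exp (-c * Real.cosh t) * Real.cosh t ^ n := by
  refine (integrable_inv_one_add_sq.const_mul
    (2 * ((n + 1).factorial / c ^ (n + 1) : ℝ))).mono' (by fun_prop) (.of_forall fun t => ?_)
  have hu := Real.cosh_pos t
  have hpos : 0 < 1 + t ^ 2 := by positivity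
  have h := Real.pow_div_factorial_le_exp (c * Real.cosh t) (by positivity) (n + 1)
  rw [Real.norm_of_nonneg (by positivity), ← div_eq_mul_inv, le_div_iff₀ hpos]
  have h1 : Real.exp (-c * Real.cosh t) * Real.cosh t ^ (n + 1) ≤
      (n + 1).factorial / c ^ (n + 1) := by
    rw [le_div_iff₀ (by positivity), neg_mul, Real.exp_neg, mul_assoc, ← mul_pow,
      mul_comm (Real.cosh t), inv_mul_le_iff₀ (Real.exp_pos _)]
    rwa [div_le_iff₀ (by positivity)] at h
  calc _ ≤ Real.exp (-c * Real.cosh t) * Real.cosh t ^ n * (2 * Real.cosh t) := by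
        gcongr
        exact Real.one_add_sq_le_two_mul_cosh t
    _ = 2 * (Real.exp (-c * Real.cosh t) * Real.cosh t ^ (n + 1)) := by ring
    _ ≤ _ := by gcongr

theorem besselK_zero_eq (x : ℝ) :
    besselK 0 x = ∫ t in Set.Ioi (0 : ℝ), Real.exp (-x * Real.cosh t) := by
  simp [besselK]

theorem besselK_one_eq (x : ℝ) :
    besselK 1 x = ∫ t in Set.Ioi (0 : ℝ), Real.exp (-x * Real.cosh t) * Real.cosh t := by
  simp [besselK]

theorem integral_exp_neg_mul_cosh_mul_cosh (x : ℝ) :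
    ∫ t : ℝ, Real.exp (-x * Real.cosh t) * Real.cosh t = 2 * besselK 1 x := by
  rw [besselK_one_eq, ← integral_comp_abs]
  simp

theorem hasDerivAt_besselK_zero {x : ℝ} (hx : 0 < x) :
    HasDerivAt (besselK 0) (-besselK 1 x) x := by
  have hI : ∀ c : ℝ, 0 < c → ∀ n : ℕ, Integrable
      (fun t : ℝ => Real.exp (-c * Real.cosh t) * Real.cosh t ^ n)
      (volume.restrict (Set.Ioi 0)) :=
    fun c hc n => (integrable_exp_neg_mul_cosh_mul_pow hc n).restrict
  have h := (hasDerivAt_integral_of_dominated_loc_of_deriv_le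
    (μ := volume.restrict (Set.Ioi (0 : ℝ))) (x₀ := x)
    (F := fun x t => Real.exp (-x * Real.cosh t))
    (F' := fun x t => -(Real.exp (-x * Real.cosh t) * Real.cosh t))
    (bound := fun t => Real.exp (-(x / 2) * Real.cosh t) * Real.cosh t)
    (Ioi_mem_nhds (half_lt_self hx)) (.of_forall fun y => by fun_prop)
    (by simpa using hI x hx 0) (by fun_prop)
    (.of_forall fun t y hy => ?_) (by simpa using hI (x / 2) (half_pos hx) 1)
    (.of_forall fun t y hy => ?_)).2
  · rw [integral_neg, ← besselK_one_eq] at h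
    exact h.congr_of_eventuallyEq (.of_forall besselK_zero_eq)
  · have := Real.cosh_pos t
    rw [norm_neg, Real.norm_of_nonneg (by positivity)]
    have hy' : x / 2 ≤ y := le_of_lt hy
    gcongr
  · have h : HasDerivAt (fun y => Real.exp (-y * Real.cosh t))
        (Real.exp (-y * Real.cosh t) * (-1 * Real.cosh t)) y :=
      ((hasDerivAt_id y).neg.mul_const (Real.cosh t)).exp
    rwa [neg_one_mul, mul_neg] at h

/-! ### Integrals along shifted horizontal lines -/

theorem Complex.norm_cosh_add_mul_I_le (t φ : ℝ) : ‖Complex.cosh (t + φ * I)‖ ≤ Real.cosh t := by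
  rw [Complex.cosh, Real.cosh_eq, norm_div]
  have := norm_add_le (exp (t + φ * I)) (exp (-(t + φ * I)))
  rw [Complex.norm_exp, Complex.norm_exp] at this
  simp at this ⊢
  linarith

theorem Complex.norm_sinh_add_mul_I_le (t φ : ℝ) : ‖Complex.sinh (t + φ * I)‖ ≤ Real.cosh t := by
  rw [Complex.sinh, Real.cosh_eq, norm_div]
  have := norm_sub_le (exp (t + φ * I)) (exp (-(t + φ * I)))
  rw [Complex.norm_exp, Complex.norm_exp] at this
  simp at this ⊢
  linarith

theorem Complex.re_cosh_add_mul_I (t φ : ℝ) :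
    (Complex.cosh (t + φ * I)).re = Real.cosh t * Real.cos φ := by
  rw [Complex.cosh_add, Complex.cosh_mul_I, Complex.sinh_mul_I, ← Complex.ofReal_cosh,
    ← Complex.ofReal_sinh, ← Complex.ofReal_cos, ← Complex.ofReal_sin]
  simp [-Complex.ofReal_cos, -Complex.ofReal_sin, -Complex.ofReal_cosh, -Complex.ofReal_sinh]

open Complex in
theorem norm_exp_neg_mul_cosh (x t φ : ℝ) :
    ‖Complex.exp (-x * Complex.cosh (t + φ * I))‖ = Real.exp (-(x * Real.cos φ) * Real.cosh t) := by
  rw [Complex.norm_exp, ← Complex.ofReal_neg, Complex.re_ofReal_mul, Complex.re_cosh_add_mul_I]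
  congr 1
  ring

open Complex in
theorem integrable_exp_neg_mul_cosh_mul_I {x φ : ℝ} (hx : 0 < x) (hφ : 0 < Real.cos φ) (ψ : ℝ) :
    Integrable fun t : ℝ => exp (-x * cosh (t + φ * I)) * cosh (t + ψ * I) := by
  refine (integrable_exp_neg_mul_cosh_mul_pow (mul_pos hx hφ) 1).mono' (by fun_prop)
    (.of_forall fun t => ?_)
  rw [norm_mul, norm_exp_neg_mul_cosh, pow_one]
  gcongr
  exact Complex.norm_cosh_add_mul_I_le _ _

open Complex in
theorem norm_deriv_exp_neg_mul_cosh_le {x c φ : ℝ} (hx : 0 < x) (hφ : c ≤ Real.cos φ) (ψ t : ℝ) :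
    ‖exp (-x * cosh (t + φ * I)) * (-x * sinh (t + φ * I)) * cosh (t + ψ * I) +
        exp (-x * cosh (t + φ * I)) * sinh (t + ψ * I)‖ ≤
      x * (Real.exp (-(x * c) * Real.cosh t) * Real.cosh t ^ 2) +
        Real.exp (-(x * c) * Real.cosh t) * Real.cosh t ^ 1 := by
  have h1 := Complex.norm_cosh_add_mul_I_le t ψ
  have h2 := Complex.norm_sinh_add_mul_I_le t ψ
  have h3 := Complex.norm_sinh_add_mul_I_le t φ
  have h0 := Real.cosh_pos t
  have h4 : ‖exp (-x * cosh (t + φ * I))‖ ≤ Real.exp (-(x * c) * Real.cosh t) := by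
    rw [norm_exp_neg_mul_cosh]
    gcongr
  refine (norm_add_le _ _).trans ?_
  simp only [norm_mul, norm_neg, Complex.norm_real, Real.norm_of_nonneg hx.le, pow_one]
  calc _ ≤ Real.exp (-(x * c) * Real.cosh t) * (x * Real.cosh t) * Real.cosh t +
        Real.exp (-(x * c) * Real.cosh t) * Real.cosh t := by gcongr
    _ = _ := by ring

open Complex in
/-- Shift of the line of integration. -/
theorem integral_exp_neg_mul_cosh_shift {x φ : ℝ} (hx : 0 < x) (hφ : |φ| < Real.pi / 2) (ψ : ℝ) :
    ∫ t : ℝ, exp (-x * cosh (t + φ * I)) * cosh (t + (φ + ψ : ℝ) * I) =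
      2 * Real.cos ψ * besselK 1 x := by
  set J : ℝ → ℂ := fun φ => ∫ t : ℝ, exp (-x * cosh (t + φ * I)) * cosh (t + (φ + ψ : ℝ) * I)
    with hJ
  -- The integrand is holomorphic in t + iφ, so its φ-derivative is i times its t-derivative, whose
  -- integral over ℝ vanishes. This replaces Cauchy's theorem.
  have hder : ∀ φ ∈ Set.Ioo (-(Real.pi / 2)) (Real.pi / 2), HasDerivAt J 0 φ := by
    intro φ hφ
    have hc := Real.cos_pos_of_mem_Ioo hφ
    have hb : Integrable fun t : ℝ =>
        x * (Real.exp (-(x * (Real.cos φ / 2)) * Real.cosh t) * Real.cosh t ^ 2) +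
        Real.exp (-(x * (Real.cos φ / 2)) * Real.cosh t) * Real.cosh t ^ 1 :=
      ((integrable_exp_neg_mul_cosh_mul_pow (mul_pos hx (half_pos hc)) 2).const_mul x).add
        (integrable_exp_neg_mul_cosh_mul_pow (mul_pos hx (half_pos hc)) 1)
    have key : ∀ z : ℂ, HasDerivAt (fun z => exp (-x * cosh z) * cosh (z + ψ * I))
        (exp (-x * cosh z) * (-x * sinh z) * cosh (z + ψ * I) +
          exp (-x * cosh z) * sinh (z + ψ * I)) z := fun z => by
      have h1 := ((Complex.hasDerivAt_cosh z).const_mul (-(x : ℂ))).cexp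
      have h2 := (Complex.hasDerivAt_cosh (z + ψ * I)).comp_add_const z (ψ * I)
      exact h1.mul h2
    have hs : ∀ t φ : ℝ, (t : ℂ) + (φ + ψ : ℝ) * I = t + φ * I + ψ * I := fun t φ => by
      push_cast; ring
    obtain ⟨hi, hd⟩ := hasDerivAt_integral_of_dominated_loc_of_deriv_le
      (μ := volume) (x₀ := φ)
      (F := fun (φ t : ℝ) => exp (-x * cosh (t + φ * I)) * cosh (t + (φ + ψ : ℝ) * I))
      (F' := fun (φ t : ℝ) =>
        (exp (-x * cosh (t + φ * I)) * (-x * sinh (t + φ * I)) * cosh (t + (φ + ψ : ℝ) * I) +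
          exp (-x * cosh (t + φ * I)) * sinh (t + (φ + ψ : ℝ) * I)) * I)
      -- A neighbourhood of φ on which the decay rate x cos y stays above x cos φ / 2, so that one
      -- bound serves for all y.
      (s := {y | Real.cos φ / 2 < Real.cos y})
      ((isOpen_lt continuous_const Real.continuous_cos).mem_nhds (half_lt_self hc))
      (.of_forall fun y => by fun_prop)
      (integrable_exp_neg_mul_cosh_mul_I hx hc _) (by fun_prop)
      (.of_forall fun t y hy => by
        rw [norm_mul, Complex.norm_I, mul_one]
        exact norm_deriv_exp_neg_mul_cosh_le hx (le_of_lt hy) _ t) hb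
      (.of_forall fun t y hy => by
        simp only [hs]
        have hl : HasDerivAt (fun y : ℝ => (t : ℂ) + y * I) I y := by
          simpa using ((Complex.ofRealCLM.hasDerivAt (x := y)).mul_const I).const_add (t : ℂ)
        exact (key _).comp y hl)
    have h0 : ∫ t : ℝ, (exp (-x * cosh (t + φ * I)) * (-x * sinh (t + φ * I)) *
        cosh (t + (φ + ψ : ℝ) * I) +
          exp (-x * cosh (t + φ * I)) * sinh (t + (φ + ψ : ℝ) * I)) = 0 := by
      refine integral_eq_zero_of_hasDerivAt_of_integrable
        (f := fun t : ℝ => exp (-x * cosh (t + φ * I)) * cosh (t + (φ + ψ : ℝ) * I))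
        (fun t => ?_) (by simpa [mul_assoc] using hi.mul_const (-I))
        (integrable_exp_neg_mul_cosh_mul_I hx hc _)
      simp only [hs]
      have hl : HasDerivAt (fun t : ℝ => (t : ℂ) + φ * I) 1 t := by
        simpa using (Complex.ofRealCLM.hasDerivAt (x := t)).add_const (φ * I)
      have h := (key _).comp t hl
      rw [mul_one] at h
      exact h
    rw [integral_mul_const, h0, zero_mul] at hd
    exact hd
  have hcon : J φ = J 0 :=
    isOpen_Ioo.is_const_of_deriv_eq_zero isPreconnected_Ioo
      (fun y hy => (hder y hy).differentiableAt.differentiableWithinAt)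
      (fun y hy => (hder y hy).deriv) (abs_lt.1 hφ)
      ⟨by linarith [Real.pi_pos], by linarith [Real.pi_pos]⟩
  have hsplit : ∀ t : ℝ, exp (-x * cosh (t + (0 : ℝ) * I)) * cosh (t + (0 + ψ : ℝ) * I) =
      ((Real.exp (-x * Real.cosh t) * Real.cosh t : ℝ) : ℂ) * Real.cos ψ +
        ((Real.exp (-x * Real.cosh t) * Real.sinh t : ℝ) : ℂ) * (Real.sin ψ * I) := fun t => by
    rw [Complex.ofReal_add, Complex.ofReal_zero, zero_mul, zero_add, add_zero, Complex.cosh_add,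
      Complex.cosh_mul_I, Complex.sinh_mul_I]
    push_cast
    ring
  have hi1 : Integrable fun t : ℝ => Real.exp (-x * Real.cosh t) * Real.cosh t := by
    simpa using integrable_exp_neg_mul_cosh_mul_pow hx 1
  have hi2 : Integrable fun t : ℝ => Real.exp (-x * Real.cosh t) * Real.sinh t := by
    refine hi1.mono (by fun_prop) (.of_forall fun t => ?_)
    rw [norm_mul, norm_mul]
    gcongr
    rw [Real.norm_eq_abs, Real.norm_of_nonneg (Real.cosh_pos t).le, abs_le]
    constructor <;> linarith [Real.cosh_add_sinh t, Real.cosh_sub_sinh t, Real.exp_pos t,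
      Real.exp_pos (-t)]
  have hodd : ∫ t : ℝ, Real.exp (-x * Real.cosh t) * Real.sinh t = 0 := by
    have h := integral_neg_eq_self (fun t : ℝ => Real.exp (-x * Real.cosh t) * Real.sinh t) volume
    simp only [Real.cosh_neg, Real.sinh_neg, mul_neg, integral_neg] at h
    simp only [neg_mul] at h ⊢
    linarith
  change J φ = _
  rw [hcon, hJ]
  simp only [hsplit]
  rw [integral_add (hi1.ofReal.mul_const _) (hi2.ofReal.mul_const _), integral_mul_const,
    integral_mul_const, integral_complex_ofReal, integral_complex_ofReal, hodd, integral_exp_neg_mul_cosh_mul_cosh]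
  push_cast
  ring

/-! ### The coefficients as integrals -/

open Complex in
theorem integrable_and_integral_exp_mul_cosh {α R ρ : ℝ} (hα : 0 < α) (hR : 0 < R) (hRρ : R < ρ)
    (θ : ℝ) :
    (Integrable fun t : ℝ =>
      exp (-(α * ρ) * cosh t) * (cosh (t + θ * I) * exp (α * R * cosh (t + θ * I)))) ∧
    ∫ t : ℝ, exp (-(α * ρ) * cosh t) * (cosh (t + θ * I) * exp (α * R * cosh (t + θ * I))) =
      (2 * ((ρ * Real.cos θ - R) / ‖(R : ℂ) - ρ * exp (-I * θ)‖) *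
        besselK 1 (α * ‖(R : ℂ) - ρ * exp (-I * θ)‖) : ℝ) := by
  have hexp : exp (-I * θ) = Real.cos θ - Real.sin θ * I := by
    rw [neg_mul, mul_comm, ← neg_mul, Complex.exp_mul_I, Complex.cos_neg, Complex.sin_neg,
      Complex.ofReal_cos, Complex.ofReal_sin]
    ring
  -- This is w = ρ - R e^{-iθ}. It has the modulus of R - ρ e^{-iθ}, and Re w > 0 puts its argument
  -- in the range where the shift is allowed.
  set w : ℂ := ⟨ρ - R * Real.cos θ, R * Real.sin θ⟩ with hw
  have hwre : 0 < w.re := by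
    change 0 < ρ - R * Real.cos θ
    nlinarith [Real.cos_le_one θ]
  have hd : ‖(R : ℂ) - ρ * exp (-I * θ)‖ = ‖w‖ := by
    rw [hexp, Complex.norm_def, Complex.norm_def]
    congr 1
    simp only [Complex.normSq_apply, hw, Complex.sub_re, Complex.sub_im, Complex.re_ofReal_mul,
      Complex.im_ofReal_mul, Complex.ofReal_re, Complex.ofReal_im, Complex.I_re, Complex.I_im]
    linear_combination (ρ ^ 2 - R ^ 2) * Real.sin_sq_add_cos_sq θ
  rw [hd]
  have hw0 : w ≠ 0 := fun h => by simp [h] at hwre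
  have hwpos : 0 < ‖w‖ := norm_pos_iff.2 hw0
  have hc : ‖w‖ * Real.cos w.arg = ρ - R * Real.cos θ := Complex.norm_mul_cos_arg w
  have hs : ‖w‖ * Real.sin w.arg = R * Real.sin θ := Complex.norm_mul_sin_arg w
  have harg : |-w.arg| < Real.pi / 2 := by
    rw [abs_neg, Complex.abs_arg_lt_pi_div_two_iff]
    exact .inl hwre
  have hfun : ∀ t : ℝ,
      exp (-(α * ρ) * cosh t) * (cosh (t + θ * I) * exp (α * R * cosh (t + θ * I))) =
      exp (-(α * ‖w‖ : ℝ) * cosh (t + (-w.arg : ℝ) * I)) *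
        cosh (t + (-w.arg + (θ + w.arg) : ℝ) * I) := fun t => by
    rw [neg_add_cancel_comm_assoc, mul_left_comm, ← Complex.exp_add, mul_comm]
    congr 2
    have hc' := congrArg ((↑) : ℝ → ℂ) hc
    have hs' := congrArg ((↑) : ℝ → ℂ) hs
    push_cast at hc' hs' ⊢
    simp only [neg_mul, Complex.cosh_add, Complex.cosh_neg, Complex.sinh_neg, Complex.cosh_mul_I,
      Complex.sinh_mul_I]
    linear_combination α * cosh t * hc' - α * sinh t * I * hs'
  simp only [hfun]
  refine ⟨integrable_exp_neg_mul_cosh_mul_I (mul_pos hα hwpos) ?_ _, ?_⟩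
  · exact Real.cos_pos_of_mem_Ioo (abs_lt.1 harg)
  · rw [integral_exp_neg_mul_cosh_shift (mul_pos hα hwpos) harg]
    -- Real part of e^{iθ} w = ρ e^{iθ} - R.
    have : Real.cos (θ + w.arg) = (ρ * Real.cos θ - R) / ‖w‖ := by
      rw [Real.cos_add, eq_div_iff hwpos.ne']
      linear_combination Real.cos θ * hc - Real.sin θ * hs - R * Real.sin_sq_add_cos_sq θ
    rw [this]
    push_cast
    ring

/-! ### Positivity of sums over roots of unity -/

-- Binomial expansion leaves positive multiples of power sums of roots of unity, each 0 or N. When N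
-- divides m - k, the term b^k ω^{l(m-k)} survives; the induction on k follows it through the
-- b-branch.
open scoped ComplexOrder in
theorem IsPrimitiveRoot.sum_zpow_mul_pow_nonneg {N : ℕ} (hN : 0 < N) {ω : ℂ}
    (hω : IsPrimitiveRoot ω N) {a b : ℝ} (ha : 0 < a) (hb : 0 < b) (k : ℕ) (m : ℤ) :
    0 ≤ ∑ l ∈ Finset.range N, (ω ^ l) ^ m * (a * ω ^ l + b * (ω ^ l)⁻¹) ^ k ∧
    ((N : ℤ) ∣ m - k →
      0 < ∑ l ∈ Finset.range N, (ω ^ l) ^ m * (a * ω ^ l + b * (ω ^ l)⁻¹) ^ k) := by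
  have hω0 : ω ≠ 0 := hω.ne_zero hN.ne'
  have ha' : (0 : ℂ) < a := by exact_mod_cast ha
  have hb' : (0 : ℂ) < b := by exact_mod_cast hb
  induction k generalizing m with
  | zero =>
    have h : ∀ l : ℕ, (ω ^ l) ^ m = (ω ^ m) ^ l := fun l => by
      rw [← zpow_natCast, ← zpow_natCast, ← zpow_mul, ← zpow_mul, mul_comm]
    simp only [pow_zero, mul_one, h, Nat.cast_zero, sub_zero, ← hω.zpow_eq_one_iff_dvd]
    by_cases h1 : ω ^ m = 1
    · simp [h1, hN]
    · refine ⟨le_of_eq ?_, fun h => absurd h h1⟩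
      rw [geom_sum_eq h1, ← h, hω.pow_eq_one, one_zpow, sub_self, zero_div]
  | succ k ih =>
    have hrec : ∑ l ∈ Finset.range N, (ω ^ l) ^ m * (a * ω ^ l + b * (ω ^ l)⁻¹) ^ (k + 1) =
        a * ∑ l ∈ Finset.range N, (ω ^ l) ^ (m + 1) * (a * ω ^ l + b * (ω ^ l)⁻¹) ^ k +
        b * ∑ l ∈ Finset.range N, (ω ^ l) ^ (m - 1) * (a * ω ^ l + b * (ω ^ l)⁻¹) ^ k := by
      rw [Finset.mul_sum, Finset.mul_sum, ← Finset.sum_add_distrib]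
      refine Finset.sum_congr rfl fun l _ => ?_
      rw [zpow_add_one₀ (pow_ne_zero l hω0), zpow_sub_one₀ (pow_ne_zero l hω0), pow_succ]
      ring
    rw [hrec]
    have h1 := mul_nonneg ha'.le (ih (m + 1)).1
    refine ⟨add_nonneg h1 (mul_nonneg hb'.le (ih (m - 1)).1), fun hd => ?_⟩
    refine add_pos_of_nonneg_of_pos h1 (mul_pos hb' ((ih (m - 1)).2 ?_))
    convert hd using 1
    push_cast
    ring

open scoped ComplexOrder in
theorem IsPrimitiveRoot.sum_pow_mul_exp_pos {N : ℕ} (hN : 0 < N) {ω : ℂ}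
    (hω : IsPrimitiveRoot ω N) {a b r : ℝ} (ha : 0 < a) (hb : 0 < b) (hr : 0 < r) (m : ℕ) :
    0 < ∑ l ∈ Finset.range N, (ω ^ l) ^ m * ((a * ω ^ l + b * (ω ^ l)⁻¹) *
      Complex.exp (r * (a * ω ^ l + b * (ω ^ l)⁻¹))) := by
  have hsum : HasSum (fun k : ℕ => ((r ^ k / k.factorial : ℝ) : ℂ) *
      ∑ l ∈ Finset.range N, (ω ^ l) ^ (m : ℤ) * (a * ω ^ l + b * (ω ^ l)⁻¹) ^ (k + 1))
      (∑ l ∈ Finset.range N, (ω ^ l) ^ m * ((a * ω ^ l + b * (ω ^ l)⁻¹) *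
        Complex.exp (r * (a * ω ^ l + b * (ω ^ l)⁻¹)))) := by
    simp only [Finset.mul_sum]
    refine hasSum_sum fun l _ => ?_
    have h := ((NormedSpace.expSeries_div_hasSum_exp
      (r * (a * ω ^ l + b * (ω ^ l)⁻¹))).mul_left (a * ω ^ l + b * (ω ^ l)⁻¹)).mul_left
      ((ω ^ l) ^ m)
    rw [← Complex.exp_eq_exp_ℂ] at h
    refine h.congr_fun fun k => ?_
    rw [zpow_natCast, mul_pow]
    push_cast
    ring
  have hnn : ∀ k : ℕ, (0 : ℂ) < ((r ^ k / k.factorial : ℝ) : ℂ) := fun k => by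
    exact_mod_cast (by positivity : 0 < r ^ k / k.factorial)
  -- At this index of the exponential series the power is m + N, congruent to m modulo N, so one
  -- term is strictly positive. Adding N keeps the subtraction honest when m = 0.
  refine lt_of_lt_of_le (mul_pos (hnn (m + N - 1))
    ((hω.sum_zpow_mul_pow_nonneg hN ha hb (m + N - 1 + 1) m).2 ?_))
    (le_hasSum hsum (m + N - 1) fun k _ =>
      mul_nonneg (hnn k).le (hω.sum_zpow_mul_pow_nonneg hN ha hb _ _).1)
  rw [Nat.sub_add_cancel (by omega)]
  simp

/-! ### Positivity of the eigenvalues -/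

theorem isPrimitiveRoot_omegaRoot {N : ℕ} (hN : 0 < N) : IsPrimitiveRoot (omegaRoot N) N :=
  Complex.isPrimitiveRoot_exp N hN.ne'

open Complex in
theorem exp_mfsAngle_mul_I (N l : ℕ) : exp (mfsAngle N l * I) = omegaRoot N ^ l := by
  rw [omegaRoot, ← Complex.exp_nat_mul, mfsAngle]
  congr 1
  push_cast
  ring

open Complex in
theorem mfsCoeff_eq_integral {α R ρ : ℝ} (hα : 0 < α) (hR : 0 < R) (hRρ : R < ρ) (N l : ℕ) :
    (mfsCoeff α R ρ N l : ℂ) = α / 2 * ∫ t : ℝ, exp (-(α * ρ) * cosh t) *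
      (cosh (t + mfsAngle N l * I) * exp (α * R * cosh (t + mfsAngle N l * I))) := by
  rw [(integrable_and_integral_exp_mul_cosh hα hR hRρ _).2, mfsCoeff]
  push_cast
  ring

open Complex in
theorem mfsPoly_omegaRoot_pow {α R ρ : ℝ} (hα : 0 < α) (hR : 0 < R) (hRρ : R < ρ) {N : ℕ}
    (hN : 0 < N) (m : ℕ) :
    (mfsPoly α R ρ N (omegaRoot N ^ m)).im = 0 ∧ 0 < (mfsPoly α R ρ N (omegaRoot N ^ m)).re := by
  set S : ℝ → ℂ := fun t => ∑ l ∈ Finset.range N, (omegaRoot N ^ l) ^ m *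
    (cosh (t + mfsAngle N l * I) * exp (α * R * cosh (t + mfsAngle N l * I))) with hS
  have hpos : ∀ t, 0 < (S t).re ∧ (S t).im = 0 := fun t => by
    have h := (isPrimitiveRoot_omegaRoot hN).sum_pow_mul_exp_pos hN
      (a := Real.exp t / 2) (b := Real.exp (-t) / 2) (by positivity) (by positivity)
      (mul_pos hα hR) m
    rw [Complex.pos_iff] at h
    have hSt : S t = ∑ l ∈ Finset.range N, (omegaRoot N ^ l) ^ m *
      (((Real.exp t / 2 : ℝ) * omegaRoot N ^ l + (Real.exp (-t) / 2 : ℝ) * (omegaRoot N ^ l)⁻¹) *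
      exp ((α * R : ℝ) * ((Real.exp t / 2 : ℝ) * omegaRoot N ^ l +
        (Real.exp (-t) / 2 : ℝ) * (omegaRoot N ^ l)⁻¹))) := by
      refine Finset.sum_congr rfl fun l _ => ?_
      have hc : cosh (t + mfsAngle N l * I) = (Real.exp t / 2 : ℝ) * omegaRoot N ^ l +
          (Real.exp (-t) / 2 : ℝ) * (omegaRoot N ^ l)⁻¹ := by
        rw [Complex.cosh, neg_add, Complex.exp_add, Complex.exp_add, Complex.exp_neg (_ * I),
          exp_mfsAngle_mul_I]
        push_cast
        ring
      rw [hc, Complex.ofReal_mul]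
    rw [hSt]
    exact ⟨h.1, h.2.symm⟩
  have hint : ∀ l, Integrable fun t : ℝ => (omegaRoot N ^ l) ^ m * (exp (-(α * ρ) * cosh t) *
      (cosh (t + mfsAngle N l * I) * exp (α * R * cosh (t + mfsAngle N l * I)))) :=
    fun l => (integrable_and_integral_exp_mul_cosh hα hR hRρ _).1.const_mul _
  have hfun : ∀ t : ℝ, ∑ l ∈ Finset.range N, (omegaRoot N ^ l) ^ m * (exp (-(α * ρ) * cosh t) *
      (cosh (t + mfsAngle N l * I) * exp (α * R * cosh (t + mfsAngle N l * I)))) =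
      ((Real.exp (-(α * ρ) * Real.cosh t) * (S t).re : ℝ) : ℂ) := fun t => by
    have : ((S t).re : ℂ) = S t := Complex.ext rfl (by simp [(hpos t).2])
    rw [Complex.ofReal_mul, this, hS, Finset.mul_sum]
    push_cast
    exact Finset.sum_congr rfl fun l _ => by ring
  have hI : Integrable fun t : ℝ => Real.exp (-(α * ρ) * Real.cosh t) * (S t).re := by
    have h := (integrable_finsetSum (Finset.range N) fun l _ => hint l).re
    simp only [hfun] at h
    exact h
  have hf : mfsPoly α R ρ N (omegaRoot N ^ m) =
      (α / 2 * ∫ t : ℝ, Real.exp (-(α * ρ) * Real.cosh t) * (S t).re : ℝ) := by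
    rw [Complex.ofReal_mul, ← integral_complex_ofReal]
    simp only [← hfun]
    rw [integral_finsetSum _ fun l _ => hint l, mfsPoly, Finset.mul_sum]
    refine Finset.sum_congr rfl fun l _ => ?_
    rw [mfsCoeff_eq_integral hα hR hRρ, integral_const_mul, ← pow_mul, ← pow_mul, mul_comm m l]
    push_cast
    ring
  rw [hf, Complex.ofReal_im, Complex.ofReal_re]
  refine ⟨rfl, mul_pos (half_pos hα) ?_⟩
  have hp : ∀ t : ℝ, 0 < Real.exp (-(α * ρ) * Real.cosh t) * (S t).re := fun t =>
    mul_pos (Real.exp_pos _) (hpos t).1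
  rw [integral_pos_iff_support_of_nonneg (fun t => (hp t).le) hI,
    Function.support_eq_univ fun t => (hp t).ne']
  simp

/-! ### Circulant structure, spectrum and invertibility -/

/-- The common form of the entries of the collocation matrix and of its coefficients, as a function
of the quotient `u` of the directions of the collocation point and the charge point. -/
noncomputable def circleKernel (α R ρ : ℝ) (u : ℂ) : ℝ :=
  (-α * besselK 1 (α * ‖(R : ℂ) - ρ * u⁻¹‖)) * ((R - ρ * u.re) / ‖(R : ℂ) - ρ * u⁻¹‖)

theorem circleKernel_inv (α R ρ : ℝ) {u : ℂ} (hu : ‖u‖ = 1) :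
    circleKernel α R ρ u⁻¹ = circleKernel α R ρ u := by
  have h : u⁻¹ = (starRingEnd ℂ) u := Complex.inv_eq_conj hu
  have hn : ‖(R : ℂ) - ρ * u‖ = ‖(R : ℂ) - ρ * u⁻¹‖ := by
    rw [h, ← Complex.norm_conj]
    simp
  rw [circleKernel, circleKernel, inv_inv, hn, h, Complex.conj_re]

theorem norm_omegaRoot {N : ℕ} (hN : 0 < N) : ‖omegaRoot N‖ = 1 :=
  (isPrimitiveRoot_omegaRoot hN).norm'_eq_one hN.ne'

theorem norm_circlePoint {r : ℝ} (hr : 0 < r) {N : ℕ} (hN : 0 < N) (k : Fin N) :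
    ‖circlePoint r N k‖ = r := by
  simp [circlePoint, norm_omegaRoot hN, abs_of_pos hr]

theorem mfsCoeff_eq_circleKernel (α R ρ : ℝ) (N l : ℕ) :
    mfsCoeff α R ρ N l = circleKernel α R ρ (omegaRoot N ^ l) := by
  rw [mfsCoeff, circleKernel, ← exp_mfsAngle_mul_I, ← Complex.exp_neg, Complex.exp_ofReal_mul_I_re,
    neg_mul Complex.I, mul_comm Complex.I]

theorem mfsMatrix_apply_eq_circleKernel (α ρ : ℝ) {R : ℝ} (hR : 0 < R) {N : ℕ} (hN : 0 < N)
    (k j : Fin N) :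
    mfsMatrix α R ρ N k j =
      circleKernel α R ρ (omegaRoot N ^ (j : ℕ) / omegaRoot N ^ (k : ℕ)) := by
  have hω : ‖omegaRoot N‖ = 1 := norm_omegaRoot hN
  have hω0 : omegaRoot N ≠ 0 := norm_ne_zero_iff.1 (by simp [hω])
  have hd : ‖circlePoint R N j - circlePoint ρ N k‖ =
      ‖(R : ℂ) - ρ * (omegaRoot N ^ (j : ℕ) / omegaRoot N ^ (k : ℕ))⁻¹‖ := by
    have : circlePoint R N j - circlePoint ρ N k = omegaRoot N ^ ((j : ℕ) + 1) *
        ((R : ℂ) - ρ * (omegaRoot N ^ (j : ℕ) / omegaRoot N ^ (k : ℕ))⁻¹) := by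
      rw [circlePoint, circlePoint, pow_succ, pow_succ]
      field_simp
    rw [this, norm_mul, norm_pow, hω, one_pow, one_mul]
  have hre : ((circlePoint R N j / (R : ℂ)) * (starRingEnd ℂ) (circlePoint ρ N k)).re =
      ρ * (omegaRoot N ^ (j : ℕ) / omegaRoot N ^ (k : ℕ)).re := by
    have hR' : (R : ℂ) ≠ 0 := by exact_mod_cast hR.ne'
    rw [← Complex.re_ofReal_mul, circlePoint, circlePoint, map_mul, map_pow, Complex.conj_ofReal,
      ← Complex.inv_eq_conj hω, inv_pow, pow_succ, pow_succ]
    congr 1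
    field_simp
  simp only [mfsMatrix, Matrix.of_apply, norm_circlePoint hR hN, hd, hre, circleKernel]

/-- Reflection in the real axis preserves the kernel. Symmetry is needed because collocation at x_j
sums over the row index k of c_{k,j}. -/
theorem mfsMatrix_transpose (α ρ : ℝ) {R : ℝ} (hR : 0 < R) {N : ℕ} (hN : 0 < N) :
    (mfsMatrix α R ρ N).transpose = mfsMatrix α R ρ N := by
  ext k j
  rw [Matrix.transpose_apply, mfsMatrix_apply_eq_circleKernel _ _ hR hN,
    mfsMatrix_apply_eq_circleKernel _ _ hR hN, ← inv_div, circleKernel_inv]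
  simp [norm_omegaRoot hN]

theorem omegaRoot_pow_sub {N : ℕ} (hN : 0 < N) (j k : Fin N) :
    omegaRoot N ^ ((j - k : Fin N) : ℕ) = omegaRoot N ^ (j : ℕ) / omegaRoot N ^ (k : ℕ) := by
  have : NeZero N := ⟨hN.ne'⟩
  have hω := isPrimitiveRoot_omegaRoot hN
  rw [eq_div_iff (pow_ne_zero _ (hω.ne_zero hN.ne')), ← pow_add,
    pow_eq_pow_mod _ hω.pow_eq_one, ← Fin.val_add, sub_add_cancel]

theorem mfsMatrix_eq_circulant (α ρ : ℝ) {R : ℝ} (hR : 0 < R) {N : ℕ} (hN : 0 < N) :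
    mfsMatrix α R ρ N =
      (Matrix.circulant fun l : Fin N => mfsCoeff α R ρ N (l : ℕ)).transpose := by
  ext k j
  rw [Matrix.transpose_apply, Matrix.circulant_apply, mfsCoeff_eq_circleKernel,
    omegaRoot_pow_sub hN, mfsMatrix_apply_eq_circleKernel _ _ hR hN]

theorem mfsMatrix_mul_vandermonde (α ρ : ℝ) {R : ℝ} (hR : 0 < R) {N : ℕ} (hN : 0 < N) :
    (mfsMatrix α R ρ N).map (fun a : ℝ => (a : ℂ)) *
        Matrix.vandermonde (fun k : Fin N => omegaRoot N ^ (k : ℕ)) =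
      Matrix.vandermonde (fun k : Fin N => omegaRoot N ^ (k : ℕ)) *
        Matrix.diagonal fun m : Fin N => mfsPoly α R ρ N (omegaRoot N ^ (m : ℕ)) := by
  have : NeZero N := ⟨hN.ne'⟩
  have hω0 := (isPrimitiveRoot_omegaRoot hN).ne_zero hN.ne'
  ext k m
  rw [Matrix.mul_diagonal, Matrix.mul_apply, mfsPoly, Finset.sum_range, Finset.mul_sum]
  -- The substitution l = j - k in `Fin N` is cyclic, which is harmless because ω^N = 1.
  refine Eq.trans (Finset.sum_congr rfl fun j _ => ?_) (Equiv.sum_comp (Equiv.subRight k) _)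
  rw [mfsMatrix_eq_circulant α ρ hR hN, Equiv.subRight_apply, Matrix.map_apply,
    Matrix.transpose_apply, Matrix.circulant_apply, Matrix.vandermonde_apply,
    Matrix.vandermonde_apply, pow_right_comm _ (m : ℕ), omegaRoot_pow_sub hN, div_pow]
  field_simp

theorem det_vandermonde_omegaRoot_ne_zero {N : ℕ} (hN : 0 < N) :
    (Matrix.vandermonde fun k : Fin N => omegaRoot N ^ (k : ℕ)).det ≠ 0 :=
  Matrix.det_vandermonde_ne_zero_iff.2 fun i j h =>
    Fin.ext ((isPrimitiveRoot_omegaRoot hN).pow_inj i.2 j.2 h)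

theorem mfsMatrix_charpoly_roots (α ρ : ℝ) {R : ℝ} (hR : 0 < R) {N : ℕ} (hN : 0 < N) :
    ((mfsMatrix α R ρ N).map (fun a : ℝ => (a : ℂ))).charpoly.roots =
      (Multiset.range N).map fun m => mfsPoly α R ρ N (omegaRoot N ^ m) := by
  have hV : IsUnit (Matrix.vandermonde fun k : Fin N => omegaRoot N ^ (k : ℕ)) :=
    (Matrix.isUnit_iff_isUnit_det _).2 (det_vandermonde_omegaRoot_ne_zero hN).isUnit
  obtain ⟨V, hV⟩ := hV
  have h := mfsMatrix_mul_vandermonde α ρ hR hN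
  rw [← hV, ← Units.eq_mul_inv_iff_mul_eq, Matrix.coe_units_inv] at h
  rw [h, Matrix.charpoly_units_conj, Matrix.charpoly_diagonal,
    ← Finset.prod_range fun m => Polynomial.X - Polynomial.C (mfsPoly α R ρ N (omegaRoot N ^ m)),
    ← Polynomial.roots_multiset_prod_X_sub_C
      ((Multiset.range N).map fun m => mfsPoly α R ρ N (omegaRoot N ^ m)), Multiset.map_map]
  rfl

theorem mfsMatrix_det_ne_zero {α R ρ : ℝ} (hα : 0 < α) (hR : 0 < R) (hRρ : R < ρ) {N : ℕ}
    (hN : 0 < N) : (mfsMatrix α R ρ N).det ≠ 0 := by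
  intro h0
  have h := congrArg Matrix.det (mfsMatrix_mul_vandermonde α ρ hR hN)
  have hmap : ((mfsMatrix α R ρ N).map (fun a : ℝ => (a : ℂ))).det = 0 := by
    have := (Complex.ofRealHom.map_det (mfsMatrix α R ρ N)).symm
    rw [h0, map_zero] at this
    exact this
  rw [Matrix.det_mul, Matrix.det_mul, hmap, zero_mul, Matrix.det_diagonal] at h
  rcases mul_eq_zero.1 h.symm with h | h
  · exact det_vandermonde_omegaRoot_ne_zero hN h
  · obtain ⟨m, -, hm⟩ := Finset.prod_eq_zero_iff.1 h
    have := (mfsPoly_omegaRoot_pow hα hR hRρ hN m).2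
    rw [hm, Complex.zero_re] at this
    exact this.false

/-! ### Normal derivatives and the collocation system -/

theorem hasNormalDerivAt_besselK_zero {α : ℝ} (hα : 0 < α) {x y : ℂ} (hx : x ≠ 0) (hxy : x ≠ y) :
    HasNormalDerivAt (fun z => besselK 0 (α * ‖z - y‖))
      ((-α * besselK 1 (α * ‖x - y‖)) *
        ((‖x‖ - ((x / (‖x‖ : ℂ)) * (starRingEnd ℂ) y).re) / ‖x - y‖)) x := by
  have hd : 0 < ‖x - y‖ := norm_pos_iff.2 (sub_ne_zero.2 hxy)
  have hw : HasDerivAt (fun t : ℝ => x + t • (x / (‖x‖ : ℂ)) - y) (x / (‖x‖ : ℂ)) 0 := by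
    simpa using (((hasDerivAt_id (0 : ℝ)).smul_const (x / (‖x‖ : ℂ))).const_add x).sub_const y
  have hn := hw.norm_sq.sqrt (by simpa using hd.ne')
  simp only [Real.sqrt_sq (norm_nonneg _), zero_smul, add_zero] at hn
  have hK := (hasDerivAt_besselK_zero (mul_pos hα hd))
  have h := HasDerivAt.comp_of_eq (0 : ℝ) hK (hn.const_mul α) (by simp)
  change HasDerivAt (fun t : ℝ => besselK 0 (α * ‖x + t • (x / (‖x‖ : ℂ)) - y‖)) _ 0
  have hin : inner ℝ (x - y) (x / (‖x‖ : ℂ)) =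
      ‖x‖ - ((x / (‖x‖ : ℂ)) * (starRingEnd ℂ) y).re := by
    rw [Complex.inner, map_sub, mul_sub, Complex.sub_re, div_mul_eq_mul_div, Complex.mul_conj']
    have : (‖x‖ : ℂ) ≠ 0 := by simpa using hx
    rw [pow_two, mul_div_cancel_right₀ _ this, Complex.ofReal_re]
  rw [hin] at h
  refine h.congr_deriv ?_
  field_simp

theorem hasNormalDerivAt_mfsFun {α R ρ : ℝ} (hα : 0 < α) (hR : 0 < R) (hRρ : R < ρ) {N : ℕ}
    (hN : 0 < N) (Q : Fin N → ℝ) (j : Fin N) :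
    HasNormalDerivAt (mfsFun α ρ N Q) ((mfsMatrix α R ρ N).mulVec Q j) (circlePoint R N j) := by
  have hx := norm_circlePoint hR hN j
  have hsum : (mfsMatrix α R ρ N).mulVec Q j = ∑ k, Q k * mfsMatrix α R ρ N k j := by
    rw [← mfsMatrix_transpose α ρ hR hN, Matrix.mulVec_transpose, Matrix.vecMul, dotProduct]
    simp only [mfsMatrix_transpose α ρ hR hN]
  rw [hsum]
  refine HasDerivAt.fun_sum fun k _ => HasDerivAt.const_mul (Q k) ?_
  refine hasNormalDerivAt_besselK_zero hα (fun h => ?_) (fun h => ?_)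
  · rw [h, norm_zero] at hx
    exact hR.ne hx
  · rw [h, norm_circlePoint (hR.trans hRρ) hN] at hx
    exact hRρ.ne' hx

theorem mulVec_mfsMatrix_eq_iff_collocates {α R ρ : ℝ} (hα : 0 < α) (hR : 0 < R) (hRρ : R < ρ)
    {N : ℕ} (hN : 0 < N) (s : ℂ → ℝ) (Q : Fin N → ℝ) :
    (mfsMatrix α R ρ N).mulVec Q = mfsRhs R N s ↔ Collocates R N s (mfsFun α ρ N Q) := by
  have h := hasNormalDerivAt_mfsFun hα hR hRρ hN Q
  refine ⟨fun hQ j => ?_, fun hQ => funext fun j => (h j).unique (hQ j)⟩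
  have := h j
  rwa [hQ] at this

theorem lt_of_sqrt_div_lt {R α ρ : ℝ} (hR : 0 < R) (hα : 0 < α)
    (hρ : Real.sqrt (4 * α ^ 2 * R ^ 2 + 6 - 2 * Real.sqrt (4 * α ^ 2 * R ^ 2 + 9)) / α < ρ) :
    R < ρ := by
  refine lt_of_le_of_lt ((le_div_iff₀ hα).2 (Real.le_sqrt_of_sq_le ?_)) hρ
  -- Rearrangement of (αR)² ≤ 4α²R² + 6 - 2√(4α²R² + 9).
  have h : Real.sqrt (4 * α ^ 2 * R ^ 2 + 9) ≤ (3 * (α * R) ^ 2 + 6) / 2 := by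
    refine Real.sqrt_le_iff.2 ⟨by positivity, ?_⟩
    nlinarith [sq_nonneg (α * R), sq_nonneg ((α * R) ^ 2)]
  nlinarith

theorem theorem1 (R α ρ : ℝ) (hR : 0 < R) (hα : 0 < α)
    (hρ : Real.sqrt (4 * α ^ 2 * R ^ 2 + 6 - 2 * Real.sqrt (4 * α ^ 2 * R ^ 2 + 9)) / α < ρ)
    (N : ℕ) (hN : 0 < N) :
    -- `G` is circulant, with first row `c_0, …, c_{N-1}`
    (mfsMatrix α R ρ N =
      (Matrix.circulant fun l : Fin N => mfsCoeff α R ρ N (l : ℕ)).transpose) ∧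
    -- its eigenvalues, with multiplicity, are `f(ω^m)`, `m = 0, …, N-1`
    (((mfsMatrix α R ρ N).map (fun a : ℝ => (a : ℂ))).charpoly.roots =
      (Multiset.range N).map fun m => mfsPoly α R ρ N (omegaRoot N ^ m)) ∧
    -- they are real and strictly positive
    (∀ m < N, (mfsPoly α R ρ N (omegaRoot N ^ m)).im = 0 ∧
      0 < (mfsPoly α R ρ N (omegaRoot N ^ m)).re) ∧
    -- the coefficients and the approximate solution are uniquely determined
    (∀ s : ℂ → ℝ,
      (∃! Q : Fin N → ℝ, (mfsMatrix α R ρ N).mulVec Q = mfsRhs R N s) ∧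
      (∀ Q : Fin N → ℝ, (mfsMatrix α R ρ N).mulVec Q = mfsRhs R N s ↔
        Collocates R N s (mfsFun α ρ N Q)) ∧
      (∃! g : ℂ → ℝ, IsMFSApproximation α R ρ N s g)) := by
  have hRρ := lt_of_sqrt_div_lt hR hα hρ
  have hcol := mulVec_mfsMatrix_eq_iff_collocates hα hR hRρ hN
  have hdet : IsUnit (mfsMatrix α R ρ N) :=
    (Matrix.isUnit_iff_isUnit_det _).2 (mfsMatrix_det_ne_zero hα hR hRρ hN).isUnit
  refine ⟨mfsMatrix_eq_circulant α ρ hR hN, mfsMatrix_charpoly_roots α ρ hR hN,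
    fun m _ => mfsPoly_omegaRoot_pow hα hR hRρ hN m, fun s => ?_⟩
  have hex : ∃! Q : Fin N → ℝ, (mfsMatrix α R ρ N).mulVec Q = mfsRhs R N s :=
    Function.Bijective.existsUnique
      ⟨Matrix.mulVec_injective_iff_isUnit.2 hdet, Matrix.mulVec_surjective_iff_isUnit.2 hdet⟩ _
  refine ⟨hex, hcol s, ?_⟩
  obtain ⟨Q, hQ, huniq⟩ := hex
  refine ⟨mfsFun α ρ N Q, ⟨Q, rfl, (hcol s Q).1 hQ⟩, ?_⟩
  rintro g ⟨Q', rfl, hQ'⟩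
  rw [huniq Q' ((hcol s Q').2 hQ')]
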